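/- Let $X\in\mathbb{R}^{n\times p}$ have columns $X_1,\dots,X_p$ of unit $\ell_2$-norm, and put $$\mu=\max_{i\neq j}|X_i^\top X_j|,\qquad \nu=\frac{1}{p-1}\max_i\Big|\sum_{j\neq i}X_i^\top X_j\Big| .$$ Let $c_\mu>10\sqrt2$ and assume that $X$ has the coherence property with constant $c_\mu$, that is, $\mu<\frac{1}{c_\mu\sqrt{\log p}}$ and $\nu<\frac{\mu}{\sqrt n}$. Let $y=X\beta+\eta$, where the entries of $\eta\in\mathbb{R}^n$ are independent and $\mathcal N(0,\sigma^2)$-distributed ($\sigma\ge 0$), and $\beta\in\mathbb{R}^p$ is a $k$-sparse vector ($k\geq 1$) whose support $\mathcal S=\{i:\beta_i\neq0\}$ is drawn uniformly at random from the $k$-subsets of $\{1,\dots,p\}$; more precisely, the nonzero values of $\beta$ are arbitrary fixed numbers $z_1,\dots,z_k\in\mathbb{R}\setminus\{0\}$, and they are placed at positions $\pi_1,\dots,\pi_k$ drawn uniformly at random without replacement from $\{1,\dots,p\}$. (No independence of $\pi$ and $\eta$ is assumed.) Let $\beta_{\min}=\min_{i\in\mathcal S}|\beta_i|$. Suppose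 that $p\ge\max\{2n,\exp(5)\}$, that $k<\frac{\mu^{-2}}{c_\mu^2\log p}$, and that, for some $c_1,c_2>2$, $$\frac{\beta_{\min}}{\|\beta\|_2}>2c_\mu c_1\,\mu\sqrt{\log p}+4c_2\frac{\sqrt{\sigma^2\log p}}{\|\beta\|_2}.$$ For $d\in\mathbb{N}$, let marginal correlation screening compute $w=X^\top y$ and return a set $\widehat{\mathcal S}\subset\{1,\dots,p\}$ of $d$ indices with the $d$ largest values of $|w_i|$ (ties broken in any way; all indices if $d\geq p$). Then for every $d\ge\lceil n/\log p\rceil$, $$\Pr\big(\mathcal S\subset\widehat{\mathcal S}\big)>1-\frac6p .$$ -/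

import Mathlib

open MeasureTheory ProbabilityTheory
open scoped ENNReal NNReal Matrix

noncomputable section

namespace ExSIS

/-- The Euclidean norm of a vector indexed by `Fin m`. -/
def l2norm {m : ℕ} (v : Fin m → ℝ) : ℝ := ‖WithLp.toLp 2 v‖

/-- All columns of `X` have unit Euclidean norm. -/
def HasUnitColumns {n p : ℕ} (X : Matrix (Fin n) (Fin p) ℝ) : Prop :=
  ∀ j, l2norm (fun i => X i j) = 1

/-- The worst-case coherence: the maximum of `|X_iᵀ X_j|` over `i ≠ j`. -/
def worstCaseCoherence {n p : ℕ} (X : Matrix (Fin n) (Fin p) ℝ) : ℝ :=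
  ⨆ q : {q : Fin p × Fin p // q.1 ≠ q.2}, |(Xᵀ * X) q.1.1 q.1.2|

/-- The average coherence: `1 / (p - 1)` times the maximum over `i` of `|∑_{j ≠ i} X_iᵀ X_j|`. -/
def averageCoherence {n p : ℕ} (X : Matrix (Fin n) (Fin p) ℝ) : ℝ :=
  1 / ((p : ℝ) - 1) * ⨆ i : Fin p, |∑ j ∈ Finset.univ.erase i, (Xᵀ * X) i j|

/-- The coherence property, with constant `c`, of a matrix with unit-norm columns. -/
def CoherenceProperty {n p : ℕ} (X : Matrix (Fin n) (Fin p) ℝ) (c : ℝ) : Prop :=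
  HasUnitColumns X ∧
    worstCaseCoherence X < 1 / (c * √(Real.log p)) ∧
    averageCoherence X < worstCaseCoherence X / √(n : ℝ)

/-- The set of indices of the nonzero entries of `β`. -/
def trueSupport {p : ℕ} (β : Fin p → ℝ) : Finset (Fin p) :=
  Finset.univ.filter fun i => β i ≠ 0

/-- The smallest absolute value of a nonzero entry of `β`. -/
def betaMin {p : ℕ} (β : Fin p → ℝ) : ℝ :=
  ⨅ i : {i : Fin p // i ∈ trueSupport β}, |β i|

/-- `S` is an output of marginal correlation screening with input `X`, `y`, `d`: it consists of
`d` indices (of all indices, if there are fewer than `d`) whose marginal correlations `|w_i|`,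
`w = Xᵀ y`, are the largest ones. Ties may be broken in any way. -/
def IsScreeningOutput {n p : ℕ} (X : Matrix (Fin n) (Fin p) ℝ) (y : Fin n → ℝ) (d : ℕ)
    (S : Finset (Fin p)) : Prop :=
  S.card = min d p ∧ ∀ i ∈ S, ∀ j ∉ S, |(Xᵀ *ᵥ y) j| ≤ |(Xᵀ *ᵥ y) i|

/-- The `k` distinct indices `π 0, …, π (k - 1)` are drawn uniformly at random, without
replacement, from the `p` indices: all injections `Fin k ↪ Fin p` are equally likely.
In other words, the set `{π a}` is uniform among the `k`-subsets and, given this set, all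
orderings of it are equally likely. -/
def IsUniformDraw {Ω : Type*} [MeasurableSpace Ω] {k p : ℕ} (P : Measure Ω)
    (π : Ω → (Fin k ↪ Fin p)) : Prop :=
  ∀ f : Fin k ↪ Fin p, MeasurableSet (π ⁻¹' {f}) ∧
    P (π ⁻¹' {f}) = (Fintype.card (Fin k ↪ Fin p) : ℝ≥0∞)⁻¹

/-- The vector with entry `z a` at position `f a` for each `a`, and zeros elsewhere. -/
def place {k p : ℕ} (z : Fin k → ℝ) (f : Fin k ↪ Fin p) : Fin p → ℝ :=
  Function.extend f z 0

end ExSIS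

end

open MeasureTheory ProbabilityTheory
open scoped ENNReal NNReal Matrix

/-! Write `w i = β i + interference + noise`. The interference is a weighted sum, with weights `z`,
of entries drawn without replacement from row `i` of the Gram matrix with its diagonal zeroed:
entries at most `μ`, mean at most `ν` in absolute value. `sum_embedding_exp_le` makes the centred
sum sub-Gaussian at scale `μ‖z‖`; the mean costs at most `√k ν ‖z‖ ≤ μ‖z‖`. With the Gaussian tail
and a union bound over `p` indices, all errors are at most `T = 17 √(log p) μ ‖z‖ + 2 σ √(log p)`
outside an event of probability `4/p`; dependence between positions and noise is harmless.

The signal condition gives `βmin > 2T`, so support entries of `|w|` beat all others. They fit among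
the `d` selected because the Welch bound, with `p ≥ 2n`, turns the sparsity condition into `k ≤ n /
log p`. -/

namespace ExSIS

/-! ### Exponential moments for sampling without replacement -/

/-- A finite form of Hoeffding's lemma for a centred function bounded by `B`. -/
theorem sum_exp_le_card_mul {ι : Type*} [Fintype ι] (h : ι → ℝ) (B : ℝ) (hB : 0 ≤ B)
    (h0 : ∑ x, h x = 0) (hb : ∀ x, |h x| ≤ B) :
    ∑ x, Real.exp (h x) ≤ Fintype.card ι * Real.exp (B ^ 2 / 2) := by
  rcases hB.eq_or_lt with rfl | hB
  · have : ∀ x, h x = 0 := fun x => abs_nonpos_iff.1 (hb x)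
    simp [this]
  -- The chord of `exp` over `[-B, B]`; its linear term sums to zero.
  have key : ∀ x, Real.exp (h x) ≤ Real.cosh B + h x * (Real.sinh B / B) := by
    intro x
    have h1 := abs_le.1 (hb x)
    have := convexOn_exp.2 (Set.mem_univ B) (Set.mem_univ (-B))
      (show 0 ≤ (B + h x) / (2 * B) from div_nonneg (by linarith) (by linarith))
      (show 0 ≤ (B - h x) / (2 * B) from div_nonneg (by linarith) (by linarith))
      (by field_simp; ring)
    have e : ((B + h x) / (2 * B)) • B + ((B - h x) / (2 * B)) • -B = h x := by
      simp only [smul_eq_mul]; field_simp; ring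
    rw [e] at this
    refine this.trans_eq ?_
    rw [Real.cosh_eq, Real.sinh_eq]
    simp only [smul_eq_mul]; field_simp; ring
  calc ∑ x, Real.exp (h x) ≤ ∑ x, (Real.cosh B + h x * (Real.sinh B / B)) :=
        Finset.sum_le_sum fun x _ => key x
    _ = Fintype.card ι * Real.cosh B := by
        rw [Finset.sum_add_distrib, ← Finset.sum_mul, h0]; simp
    _ ≤ _ := by gcongr; exact Real.cosh_le_exp_half_sq B

/-- The growth of the sub-Gaussian constant when one more index is drawn. -/
theorem subgaussian_constant_step (m k : ℝ) (hk : 0 ≤ k) (hkm : 4 * (k + 1) ≤ m) (s q w : ℝ)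
    (hs : s ^ 2 ≤ k * q) (hq : 0 ≤ q) :
    (m + 1) / (m - k + 1) * (q - 2 * (w / (m - k)) * s + k * (w / (m - k)) ^ 2) + w ^ 2 / 2
      ≤ (m + 1) / (m - k) * (w ^ 2 + q) := by
  have hr : 0 < m - k := by linarith
  set r := m - k with hrdef
  have hm : m = r + k := by rw [hrdef]; ring
  -- Complete the square: `k` times the numerator below is at least `(k * w + s) ^ 2`, using `s ^ 2
  -- ≤ k * q`.
  have hcross : -(2 * (w / r) * s) ≤ q / r + k * w ^ 2 / r := by
    have : q / r + k * w ^ 2 / r + 2 * (w / r) * s = (q + k * w ^ 2 + 2 * w * s) / r := by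
      field_simp
    have hnn : 0 ≤ (q + k * w ^ 2 + 2 * w * s) / r := by
      apply div_nonneg _ hr.le
      rcases hk.eq_or_lt with rfl | hk
      · have : s = 0 := by nlinarith
        subst this; nlinarith
      · have : 0 ≤ k * (q + k * w ^ 2 + 2 * w * s) := by nlinarith [sq_nonneg (k * w + s)]
        exact nonneg_of_mul_nonneg_right this hk
    linarith
  have hc : 0 ≤ (m + 1) / (r + 1) := by apply div_nonneg <;> linarith
  have h1 : (m + 1) / (r + 1) * (q - 2 * (w / r) * s + k * (w / r) ^ 2) ≤
      (m + 1) / (r + 1) * (q * (1 + 1 / r) + w ^ 2 * (k * (r + 1) / r ^ 2)) := by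
    apply mul_le_mul_of_nonneg_left _ hc
    have : q * (1 + 1 / r) + w ^ 2 * (k * (r + 1) / r ^ 2) =
      q + (q / r + k * w ^ 2 / r) + k * (w / r) ^ 2 := by field_simp; ring
    rw [this]; linarith
  have h2 : (m + 1) / (r + 1) * (q * (1 + 1 / r) + w ^ 2 * (k * (r + 1) / r ^ 2)) =
      (m + 1) / r * q + w ^ 2 * ((m + 1) * k / r ^ 2) := by
    field_simp
  have h3 : (m + 1) * k / r ^ 2 + 1 / 2 ≤ (m + 1) / r := by
    have : (m + 1) / r - ((m + 1) * k / r ^ 2 + 1 / 2) =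
      (2 * (m + 1) * r - 2 * (m + 1) * k - r ^ 2) / (2 * r ^ 2) := by field_simp; ring
    have h4 : 0 ≤ (2 * (m + 1) * r - 2 * (m + 1) * k - r ^ 2) / (2 * r ^ 2) := by
      apply div_nonneg _ (by positivity)
      have : 3 * k ≤ r := by linarith
      rw [hm]; nlinarith
    linarith
  nlinarith [mul_le_mul_of_nonneg_left h3 (sq_nonneg w)]

/-- The moment generating function of a weighted sum sampled without replacement from a centred
population. -/
theorem sum_embedding_exp_le {α : Type*} [Fintype α] [DecidableEq α] (g : α → ℝ) (D : ℝ)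
    (hg : ∑ x, g x = 0) (hD : ∀ x y, |g x - g y| ≤ D) (k : ℕ) (hk : 4 * k ≤ Fintype.card α)
    (z : Fin k → ℝ) :
    ∑ f : Fin k ↪ α, Real.exp (∑ a, z a * g (f a)) ≤ Fintype.card (Fin k ↪ α) *
      Real.exp (((Fintype.card α : ℝ) + 1) / ((Fintype.card α : ℝ) - k + 1) *
        (∑ a, z a ^ 2) * D ^ 2) := by
  induction k with
  | zero => simp
  | succ k ih =>
    set m := Fintype.card α with hm
    have hkm : (4 : ℝ) * (k + 1) ≤ m := by exact_mod_cast hk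
    have hkm' : k ≤ m := by omega
    have hr : (0 : ℝ) < m - k := by
      have : (0 : ℝ) ≤ k := k.cast_nonneg
      linarith
    have hcard : (Fintype.card (Fin (k + 1) ↪ α) : ℝ) = (m - k) * Fintype.card (Fin k ↪ α) := by
      rw [Fintype.card_embedding_eq, Fintype.card_embedding_eq, Fintype.card_fin, Fintype.card_fin,
        Nat.descFactorial_succ, Nat.cast_mul, Nat.cast_sub hkm']
    have hcompl : ∀ e : Fin k ↪ α, (Fintype.card {i // i ∉ Set.range e} : ℝ) = m - k := by
      intro e
      have : Fintype.card {i // i ∉ Set.range e} = m - k := by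
        rw [Fintype.card_subtype_compl]
        congr 1
        exact (Fintype.card_congr (Equiv.ofInjective e e.injective).symm).trans (Fintype.card_fin k)
      rw [this, Nat.cast_sub hkm']
    set w := z 0
    -- Given the other draws `e`, the mean of `g` over the unused indices is `-(∑ a, g (e a)) / (m -
    -- k)`; Hoeffding's lemma handles the deviation from it.
    have hinner : ∀ e : Fin k ↪ α, ∑ x : {i // i ∉ Set.range e}, Real.exp (w * g x) ≤
        Real.exp (-(w / (m - k)) * ∑ a, g (e a)) * ((m - k) * Real.exp (w ^ 2 * D ^ 2 / 2)) := by
      intro e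
      have hsum : ∑ x : {i // i ∉ Set.range e}, g x = -∑ a, g (e a) := by
        have h1 := Fintype.sum_subtype_add_sum_subtype (fun i => i ∈ Set.range e) g
        have h2 : ∀ inst : Fintype {i // i ∈ Set.range e},
            (@Finset.univ _ inst).sum (fun x => g x) = ∑ a, g (e a) := fun inst =>
          (Fintype.sum_equiv (Equiv.ofInjective e e.injective) _ _ (fun a => rfl)).symm
        rw [h2] at h1
        linarith
      set G := -∑ a, g (e a) with hG
      have hB := sum_exp_le_card_mul (fun x : {i // i ∉ Set.range e} => w * (g x - G / (m - k)))
        (|w| * D) ?_ ?_ ?_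
      · rw [hcompl e, mul_pow, sq_abs] at hB
        have : ∀ x : {i // i ∉ Set.range e}, Real.exp (w * g x) =
            Real.exp (-(w / (m - k)) * ∑ a, g (e a)) * Real.exp (w * (g x - G / (m - k))) := by
          intro x
          rw [← Real.exp_add, hG]; congr 1; ring
        simp_rw [this]
        rw [← Finset.mul_sum]
        gcongr
      · obtain ⟨x⟩ : Nonempty α := Fintype.card_pos_iff.1 (by omega)
        exact mul_nonneg (abs_nonneg _) ((abs_nonneg _).trans (hD x x))
      · rw [← Finset.mul_sum, Finset.sum_sub_distrib, hsum]
        simp only [Finset.sum_const, Finset.card_univ, nsmul_eq_mul]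
        rw [hcompl e]; field_simp; ring
      · intro x
        rw [abs_mul]
        refine mul_le_mul_of_nonneg_left ?_ (abs_nonneg _)
        -- The deviation from the mean is an average of differences of `g`, so the oscillation `D`
        -- bounds it whatever has been removed.
        have h1 : g x - G / (m - k) =
            (∑ y : {i // i ∉ Set.range e}, (g x - g y)) / (m - k) := by
          rw [Finset.sum_sub_distrib, hsum]
          simp only [Finset.sum_const, Finset.card_univ, nsmul_eq_mul]
          rw [hcompl e]; field_simp
        rw [h1, abs_div, abs_of_pos hr, div_le_iff₀ hr]
        calc _ ≤ ∑ y : {i // i ∉ Set.range e}, |g x - g y| := Finset.abs_sum_le_sum_abs _ _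
          _ ≤ ∑ y : {i // i ∉ Set.range e}, D := Finset.sum_le_sum fun y _ => hD _ _
          _ = _ := by
            simp only [Finset.sum_const, Finset.card_univ, nsmul_eq_mul]
            rw [hcompl e]; ring
    -- Index `0` is treated as the last draw, taken from the complement of the range of the others.
    have hsplit : ∑ f : Fin (k + 1) ↪ α, Real.exp (∑ a, z a * g (f a)) =
        ∑ e : Fin k ↪ α, Real.exp (∑ a, z (Fin.succ a) * g (e a)) *
          ∑ x : {i // i ∉ Set.range e}, Real.exp (w * g x) := by
      simp_rw [Finset.mul_sum]
      rw [← Fintype.sum_sigma', ← (Equiv.embeddingFinSucc k α).sum_comp]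
      refine Finset.sum_congr rfl fun f _ => ?_
      rw [← Real.exp_add, Fin.sum_univ_succ, add_comm]
      rfl
    -- The conditional mean of the last draw is linear in the earlier values, so it only shifts
    -- their weights.
    have hih := ih (by omega) (fun a => z (Fin.succ a) - w / (m - k))
    rw [hsplit, hcard]
    calc _ ≤ ∑ e : Fin k ↪ α, Real.exp (∑ a, z (Fin.succ a) * g (e a)) *
          (Real.exp (-(w / (m - k)) * ∑ a, g (e a)) * ((m - k) * Real.exp (w ^ 2 * D ^ 2 / 2))) :=
          Finset.sum_le_sum fun e _ => mul_le_mul_of_nonneg_left (hinner e) (Real.exp_pos _).le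
      _ = (∑ e : Fin k ↪ α, Real.exp (∑ a, (z (Fin.succ a) - w / (m - k)) * g (e a))) *
          ((m - k) * Real.exp (w ^ 2 * D ^ 2 / 2)) := by
          rw [Finset.sum_mul]
          refine Finset.sum_congr rfl fun e _ => ?_
          rw [← mul_assoc, ← Real.exp_add]
          congr 2
          rw [Finset.mul_sum, ← Finset.sum_add_distrib]
          exact Finset.sum_congr rfl fun a _ => by ring
      _ ≤ _ := by
          refine (mul_le_mul_of_nonneg_right hih (by positivity)).trans ?_
          have hre : ∀ A E F : ℝ, A * E * ((m - k) * F) = (m - k) * A * (E * F) := by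
            intros; ring
          rw [hre, ← Real.exp_add]
          refine mul_le_mul_of_nonneg_left (Real.exp_le_exp.2 ?_) (by positivity)
          have hstep := subgaussian_constant_step m k k.cast_nonneg hkm
            (∑ a : Fin k, z a.succ) (∑ a : Fin k, z a.succ ^ 2) w
            (by
              have := sq_sum_le_card_mul_sum_sq (s := Finset.univ) (f := fun a : Fin k => z a.succ)
              simpa using this)
            (Finset.sum_nonneg fun _ _ => sq_nonneg _)
          have hexp : ∑ a : Fin k, (z a.succ - w / (m - k)) ^ 2 =
              (∑ a : Fin k, z a.succ ^ 2) - 2 * (w / (m - k)) * (∑ a : Fin k, z a.succ) +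
                k * (w / (m - k)) ^ 2 := by
            simp_rw [sub_sq]
            rw [Finset.sum_add_distrib, Finset.sum_sub_distrib, Finset.mul_sum]
            simp only [Finset.sum_const, Finset.card_univ, Fintype.card_fin, nsmul_eq_mul]
            congr 2
            exact Finset.sum_congr rfl fun a _ => by ring
          rw [hexp, Fin.sum_univ_succ]
          have hcast : (m : ℝ) - ((k + 1 : ℕ) : ℝ) + 1 = m - k := by push_cast; ring
          rw [hcast]
          have := mul_le_mul_of_nonneg_right hstep (sq_nonneg D)
          refine le_trans (le_of_eq ?_) this
          ring

end ExSIS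

namespace ExSIS

/-! ### Tail bounds for interference and noise -/

/-- Chernoff bound for a weighted sum sampled without replacement from a centred population. -/
theorem card_filter_embedding_le {α : Type*} [Fintype α] [DecidableEq α] {k : ℕ} (g : α → ℝ)
    (M N L : ℝ) (hM : 0 < M) (hN : 0 < N) (hL : 0 ≤ L) (hg : ∑ x, g x = 0)
    (hD : ∀ x y, |g x - g y| ≤ 2 * M) (hk : 4 * k ≤ Fintype.card α) (z : Fin k → ℝ)
    (hz : ∑ a, z a ^ 2 = N ^ 2) :
    ((Finset.univ.filter fun f : Fin k ↪ α => 16 * √L * M * N ≤ ∑ a, z a * g (f a)).card : ℝ) ≤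
      Fintype.card (Fin k ↪ α) * Real.exp (-(2 * L)) := by
  -- With this `t` the moment bound costs at most `6 * L` and the threshold gains `16 * L`, more
  -- than the `2 * L` needed.
  set t := √L / (M * N)
  have ht : 0 ≤ t := by positivity
  have h := sum_embedding_exp_le g (2 * M) hg hD k hk (fun a => t * z a)
  have h1 : ∀ f : Fin k ↪ α, ∑ a, t * z a * g (f a) = t * ∑ a, z a * g (f a) := fun f => by
    rw [Finset.mul_sum]; exact Finset.sum_congr rfl fun a _ => by ring
  simp_rw [h1, mul_pow, ← Finset.mul_sum, hz] at h
  have hk' : 4 * (k : ℝ) ≤ Fintype.card α := by exact_mod_cast hk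
  generalize (Fintype.card α : ℝ) = m at h hk'
  have hq : (m + 1) / (m - k + 1) ≤ 3 / 2 := by
    have : (0 : ℝ) ≤ k := k.cast_nonneg
    rw [div_le_iff₀ (by linarith)]; linarith
  have htL : t ^ 2 * (M ^ 2 * N ^ 2) = L := by
    have : t ^ 2 = L / (M ^ 2 * N ^ 2) := by
      simp only [t]; rw [div_pow, Real.sq_sqrt hL, mul_pow]
    rw [this]; field_simp
  have hexp : (m + 1) / (m - k + 1) * (t ^ 2 * N ^ 2) * (2 ^ 2 * M ^ 2) ≤ 6 * L := by
    have : (m + 1) / (m - k + 1) * (t ^ 2 * N ^ 2) * (2 ^ 2 * M ^ 2) =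
      (m + 1) / (m - k + 1) * (4 * L) := by rw [← htL]; ring
    rw [this]; nlinarith
  have htu : t * (16 * √L * M * N) = 16 * L := by
    simp only [t]; field_simp; rw [Real.sq_sqrt hL]
  have hlow : ((Finset.univ.filter fun f : Fin k ↪ α =>
      16 * √L * M * N ≤ ∑ a, z a * g (f a)).card : ℝ) * Real.exp (16 * L) ≤
      ∑ f : Fin k ↪ α, Real.exp (t * ∑ a, z a * g (f a)) := by
    rw [← nsmul_eq_mul, ← Finset.sum_const]
    refine le_trans (Finset.sum_le_sum fun f hf => ?_)
      (Finset.sum_le_sum_of_subset_of_nonneg (Finset.filter_subset _ _)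
        fun _ _ _ => (Real.exp_pos _).le)
    rw [← htu]
    exact Real.exp_le_exp.2 (mul_le_mul_of_nonneg_left (Finset.mem_filter.1 hf).2 ht)
  have h2 : (Fintype.card (Fin k ↪ α) : ℝ) * Real.exp (6 * L) ≤
      Fintype.card (Fin k ↪ α) * Real.exp (-(2 * L)) * Real.exp (16 * L) := by
    rw [mul_assoc, ← Real.exp_add]
    gcongr; linarith
  refine le_of_mul_le_mul_right (hlow.trans (h.trans (le_trans ?_ h2))) (Real.exp_pos _)
  gcongr

section Sampling

variable {Ω : Type*} [MeasurableSpace Ω] {P : Measure Ω} {k p : ℕ} {π : Ω → (Fin k ↪ Fin p)}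

theorem IsUniformDraw.measureReal_le (hπ : IsUniformDraw P π) (A : Finset (Fin k ↪ Fin p)) :
    P.real {ω | π ω ∈ A} ≤ A.card / Fintype.card (Fin k ↪ Fin p) := by
  have h1 : {ω | π ω ∈ A} = ⋃ f ∈ A, π ⁻¹' {f} := by ext ω; simp
  rw [h1]
  refine ENNReal.toReal_le_of_le_ofReal (by positivity) ((measure_biUnion_finset_le _ _).trans ?_)
  simp_rw [fun f => (hπ f).2]
  rcases A.eq_empty_or_nonempty with rfl | ⟨f, -⟩
  · simp
  have hc : 0 < Fintype.card (Fin k ↪ Fin p) := Fintype.card_pos_iff.2 ⟨f⟩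
  rw [Finset.sum_const, nsmul_eq_mul, div_eq_mul_inv, ENNReal.ofReal_mul (by positivity),
    ENNReal.ofReal_inv_of_pos (by exact_mod_cast hc), ENNReal.ofReal_natCast, ENNReal.ofReal_natCast]

/-- Tail bound for a weighted sum sampled without replacement from a bounded population whose mean
is at most `b` in absolute value. -/
theorem IsUniformDraw.measureReal_abs_sum_le (hπ : IsUniformDraw P π) [IsFiniteMeasure P]
    (g : Fin p → ℝ)
    (M N L b : ℝ) (hM : 0 < M) (hN : 0 < N) (hL : 0 ≤ L) (hg : ∀ x, |g x| ≤ M)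
    (hb : |∑ x, g x| ≤ p * b) (hk0 : 0 < k) (hk : 4 * k ≤ p) (z : Fin k → ℝ)
    (hz : ∑ a, z a ^ 2 = N ^ 2) :
    P.real {ω | 16 * √L * M * N + √k * b * N < |∑ a, z a * g (π ω a)|} ≤
      2 * Real.exp (-(2 * L)) := by
  have hp : (0 : ℝ) < p := by exact_mod_cast (by omega : 0 < p)
  set c := (∑ x, g x) / p with hc
  have hcb : |c| ≤ b := by
    rw [hc, abs_div, Nat.abs_cast, div_le_iff₀ hp]; linarith
  have hzs : |∑ a, z a| ≤ √k * N := by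
    have h1 := sq_sum_le_card_mul_sum_sq (s := Finset.univ) (f := z)
    rw [hz, Finset.card_univ, Fintype.card_fin] at h1
    refine abs_le_of_sq_le_sq ?_ (by positivity)
    rwa [mul_pow, Real.sq_sqrt k.cast_nonneg]
  have hE : (0 : ℝ) < Fintype.card (Fin k ↪ Fin p) := by
    have : 0 < Fintype.card (Fin k ↪ Fin p) :=
      Fintype.card_pos_iff.2 ⟨Fin.castLEEmb (by omega)⟩
    exact_mod_cast this
  -- The signs `s = 1` and `s = -1` give the two tails of the centred sum.
  have side : ∀ s : ℝ, |s| = 1 → P.real {ω | π ω ∈ Finset.univ.filter fun f : Fin k ↪ Fin p =>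
      16 * √L * M * N ≤ ∑ a, z a * (s * (g (f a) - c))} ≤ Real.exp (-(2 * L)) := by
    intro s hs
    refine (hπ.measureReal_le _).trans ((div_le_iff₀ hE).2 ?_)
    rw [mul_comm (Real.exp _)]
    refine card_filter_embedding_le (fun x => s * (g x - c)) M N L hM hN hL ?_ ?_ (by simpa) z hz
    · rw [← Finset.mul_sum, Finset.sum_sub_distrib]
      simp [hc]; right; field_simp; simp
    · intro x y
      rw [← mul_sub, abs_mul, hs, one_mul, sub_sub_sub_cancel_right]
      exact (abs_sub _ _).trans (by linarith [hg x, hg y])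
  calc _ ≤ P.real ({ω | π ω ∈ Finset.univ.filter fun f : Fin k ↪ Fin p =>
        16 * √L * M * N ≤ ∑ a, z a * (1 * (g (f a) - c))} ∪
        {ω | π ω ∈ Finset.univ.filter fun f : Fin k ↪ Fin p =>
        16 * √L * M * N ≤ ∑ a, z a * (-1 * (g (f a) - c))}) := by
        refine measureReal_mono fun ω hω => ?_
        simp only [Set.mem_ofPred_eq] at hω
        have e : ∀ s : ℝ, ∑ a, z a * (s * (g (π ω a) - c)) =
            s * (∑ a, z a * g (π ω a) - c * ∑ a, z a) := fun s => by
          rw [Finset.mul_sum, ← Finset.sum_sub_distrib, Finset.mul_sum]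
          exact Finset.sum_congr rfl fun a _ => by ring
        simp only [Set.mem_union, Set.mem_ofPred_eq, Finset.mem_filter, Finset.mem_univ, true_and, e]
        have h2 : |c * ∑ a, z a| ≤ √k * b * N := by
          rw [abs_mul]
          calc _ ≤ b * (√k * N) := mul_le_mul hcb hzs (abs_nonneg _) ((abs_nonneg _).trans hcb)
            _ = _ := by ring
        have h3 := abs_le.1 h2
        rcases lt_abs.1 hω with h | h
        · left; linarith
        · right; linarith
    _ ≤ _ := (measureReal_union_le _ _).trans (by
        linarith [side 1 (by simp), side (-1) (by simp)])

end Sampling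

/-- Tail bound for a unit-norm linear combination of independent centred Gaussian variables. -/
theorem measureReal_abs_gaussian_sum_le {Ω : Type*} [MeasurableSpace Ω] {P : Measure Ω}
    [IsProbabilityMeasure P] {n : ℕ} (σ : ℝ≥0) (η : Ω → Fin n → ℝ)
    (hη_law : ∀ i, HasLaw (fun ω => η ω i) (gaussianReal 0 (σ ^ 2)) P)
    (hη_indep : iIndepFun (fun i ω => η ω i) P) (x : Fin n → ℝ) (hx : ∑ i, x i ^ 2 = 1) (L : ℝ)
    (hL : 0 ≤ L) :
    P.real {ω | 2 * σ * √L < |∑ i, x i * η ω i|} ≤ 2 * Real.exp (-(2 * L)) := by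
  have hsub : ∀ i, HasSubgaussianMGF (fun ω => η ω i) (σ ^ 2) P := fun i => by
    have hm := (hη_law i).map_eq
    refine ⟨fun t => ?_, fun t => ?_⟩
    · have h1 := integrable_exp_mul_gaussianReal (μ := 0) (v := σ ^ 2) t
      rw [← hm] at h1
      exact h1.comp_aemeasurable (hη_law i).aemeasurable
    · rw [mgf_gaussianReal hm]; simp
  have hmul : ∀ i, HasSubgaussianMGF (fun ω => x i * η ω i) (‖x i‖₊ ^ 2 * σ ^ 2) P := fun i => by
    have e : ‖x i‖₊ ^ 2 = NNReal.mk (x i ^ 2) (sq_nonneg _) := NNReal.eq (by simp)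
    rw [e]
    exact (hsub i).const_mul (x i)
  have hV : HasSubgaussianMGF (fun ω => ∑ i, x i * η ω i) (σ ^ 2) P := by
    have h := HasSubgaussianMGF.sum_of_iIndepFun (s := Finset.univ)
      (hη_indep.comp (fun i => (x i * ·)) (fun i => measurable_const_mul _))
      (fun i _ => hmul i)
    have hs : ∑ i, ‖x i‖₊ ^ 2 = 1 := by
      ext; simpa using hx
    rw [← Finset.sum_mul, hs, one_mul] at h
    exact h
  rcases eq_or_ne σ 0 with rfl | hσ
  -- At `σ = 0` the Chernoff exponent divides by zero; the strict inequality in the event makes it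
  -- null.
  · have h0 : (fun ω => ∑ i, x i * η ω i) =ᵐ[P] 0 := by
      apply HasSubgaussianMGF.ae_eq_zero_of_hasSubgaussianMGF_zero
      simpa using hV
    have : P {ω | 2 * ((0 : ℝ≥0) : ℝ) * √L < |∑ i, x i * η ω i|} = 0 := by
      refine measure_mono_null (fun ω hω => ?_) (ae_iff.1 h0)
      intro h
      simp [h] at hω
    rw [measureReal_def, this]
    simp; positivity
  have hσ' : (0 : ℝ) < σ := by positivity
  have e : -(2 * σ * √L) ^ 2 / (2 * ((σ ^ 2 : ℝ≥0) : ℝ)) = -(2 * L) := by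
    push_cast
    rw [mul_pow, Real.sq_sqrt hL]; field_simp
  have h1 := hV.measure_ge_le (ε := 2 * σ * √L) (by positivity)
  have h2 := hV.neg.measure_ge_le (ε := 2 * σ * √L) (by positivity)
  rw [e] at h1 h2
  refine (measureReal_mono (s₂ := {ω | 2 * σ * √L ≤ ∑ i, x i * η ω i} ∪
    {ω | 2 * σ * √L ≤ (-fun ω => ∑ i, x i * η ω i) ω}) fun ω hω => ?_).trans
    ((measureReal_union_le _ _).trans (by linarith))
  rcases lt_abs.1 (Set.mem_ofPred_eq ▸ hω) with h | h
  · exact Or.inl h.le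
  · exact Or.inr h.le

/-! ### Deterministic selection and the placed vector -/

/-- If every coordinate of `w` is within `T` of that of `β`, and the nonzero entries of `β` exceed
`2 * T`, then the coordinates of `w` on the support of `β` are selected first. -/
theorem trueSupport_subset_of_abs_sub_le {p : ℕ} (β w : Fin p → ℝ) (T : ℝ)
    (hw : ∀ i, |w i - β i| ≤ T) (hT : ∀ i ∈ trueSupport β, 2 * T < |β i|) {d : ℕ}
    (hd : (trueSupport β).card ≤ d) (S : Finset (Fin p)) (hS : S.card = min d p)
    (hSw : ∀ i ∈ S, ∀ j ∉ S, |w j| ≤ |w i|) : trueSupport β ⊆ S := by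
  intro i hi
  by_contra hiS
  -- A selected `j` off the support would have `|w j| ≤ T < |w i|` with `i` unselected. So `S` is
  -- smaller than the support, hence than `min d p`.
  have hsub : S ⊆ (trueSupport β).erase i := by
    intro j hj
    refine Finset.mem_erase.2 ⟨fun h => hiS (h ▸ hj), ?_⟩
    by_contra hjβ
    have h0 : β j = 0 := by simpa [trueSupport] using hjβ
    have h1 := hw j
    rw [h0, sub_zero] at h1
    have h2 := hSw j hj i hiS
    have h3 := abs_sub_abs_le_abs_sub (β i) (w i)
    rw [abs_sub_comm] at h3
    linarith [hT i hi, hw i]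
  have h1 := Finset.card_le_card hsub
  have h2 := Finset.card_erase_lt_of_mem hi
  have h3 : (trueSupport β).card ≤ p := by simpa using Finset.card_le_univ (trueSupport β)
  omega

section Place

variable {k p : ℕ} (z : Fin k → ℝ) (f : Fin k ↪ Fin p)

theorem place_apply (a : Fin k) : place z f (f a) = z a := f.injective.extend_apply _ _ _

theorem sum_apply_place (φ : Fin p → ℝ → ℝ) (hφ : ∀ j, φ j 0 = 0) :
    ∑ j, φ j (place z f j) = ∑ a, φ (f a) (z a) := by
  rw [← Finset.sum_subset (Finset.subset_univ (Finset.univ.map f)), Finset.sum_map]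
  · simp_rw [place_apply]
  · intro j _ hj
    have : ¬ ∃ a, f a = j := by simpa using hj
    rw [place, Function.extend_apply' _ _ _ this, Pi.zero_apply, hφ]

theorem l2norm_sq {m : ℕ} (v : Fin m → ℝ) : l2norm v ^ 2 = ∑ i, v i ^ 2 := by
  rw [l2norm, EuclideanSpace.real_norm_sq_eq]

theorem card_trueSupport_place_le : (trueSupport (place z f)).card ≤ k := by
  have : trueSupport (place z f) ⊆ Finset.univ.map f := by
    intro j hj
    by_contra h
    have h' : ¬ ∃ a, f a = j := by simpa using h
    have hj' : place z f j ≠ 0 := by simpa [trueSupport] using hj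
    exact hj' (by rw [place, Function.extend_apply' _ _ _ h', Pi.zero_apply])
  simpa using Finset.card_le_card this

theorem betaMin_le (β : Fin p → ℝ) (i : Fin p) (hi : i ∈ trueSupport β) : betaMin β ≤ |β i| :=
  ciInf_le ⟨0, by rintro _ ⟨j, rfl⟩; exact abs_nonneg _⟩
    (⟨i, hi⟩ : {i : Fin p // i ∈ trueSupport β})

end Place

/-! ### Coherence and the Welch bound -/

section Coherence

variable {n p : ℕ} (X : Matrix (Fin n) (Fin p) ℝ)

theorem abs_gram_le_worstCaseCoherence {i j : Fin p} (h : i ≠ j) :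
    |(Xᵀ * X) i j| ≤ worstCaseCoherence X :=
  le_ciSup (f := fun q : {q : Fin p × Fin p // q.1 ≠ q.2} => |(Xᵀ * X) q.1.1 q.1.2|)
    (Set.finite_range _).bddAbove ⟨(i, j), h⟩

theorem abs_sum_gram_le_averageCoherence (hp : 1 < p) (i : Fin p) :
    |∑ j ∈ Finset.univ.erase i, (Xᵀ * X) i j| ≤ (p - 1) * averageCoherence X := by
  have hp' : (1 : ℝ) < p := by exact_mod_cast hp
  have h := le_ciSup (f := fun i : Fin p => |∑ j ∈ Finset.univ.erase i, (Xᵀ * X) i j|)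
    (Set.finite_range _).bddAbove i
  refine h.trans_eq ?_
  rw [averageCoherence, ← mul_assoc, mul_one_div_cancel (by linarith), one_mul]

theorem averageCoherence_nonneg (hp : 1 < p) : 0 ≤ averageCoherence X := by
  have hp' : (1 : ℝ) < p := by exact_mod_cast hp
  exact mul_nonneg (one_div_nonneg.2 (by linarith)) (Real.iSup_nonneg fun _ => abs_nonneg _)

variable {X}

theorem HasUnitColumns.sum_sq (hX : HasUnitColumns X) (j : Fin p) : ∑ i, X i j ^ 2 = 1 := by
  have h := l2norm_sq fun i => X i j
  rw [hX j] at h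
  linarith

theorem HasUnitColumns.gram_self (hX : HasUnitColumns X) (j : Fin p) : (Xᵀ * X) j j = 1 := by
  rw [Matrix.mul_apply, ← hX.sum_sq j]
  exact Finset.sum_congr rfl fun i _ => by rw [Matrix.transpose_apply, sq]

/-- The Welch bound on the worst-case coherence. -/
theorem HasUnitColumns.welch (hX : HasUnitColumns X) (hp : 1 ≤ p) :
    (p : ℝ) ≤ n * (1 + (p - 1) * worstCaseCoherence X ^ 2) := by
  have hp' : (1 : ℝ) ≤ p := by exact_mod_cast hp
  -- `X Xᵀ` and `Xᵀ X` have the same Frobenius norm.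
  have hfrob : ∑ a, ∑ b, (∑ j, X a j * X b j) ^ 2 = ∑ j, ∑ l, ((Xᵀ * X) j l) ^ 2 := by
    simp_rw [Matrix.mul_apply, Matrix.transpose_apply, sq, Finset.sum_mul_sum]
    calc _ = ∑ a, ∑ j, ∑ b, ∑ l, X a j * X b j * (X a l * X b l) :=
          Finset.sum_congr rfl fun a _ => Finset.sum_comm
      _ = ∑ j, ∑ a, ∑ l, ∑ b, X a j * X b j * (X a l * X b l) := by
          rw [Finset.sum_comm]
          exact Finset.sum_congr rfl fun j _ => Finset.sum_congr rfl fun a _ => Finset.sum_comm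
      _ = ∑ j, ∑ l, ∑ a, ∑ b, X a j * X b j * (X a l * X b l) :=
          Finset.sum_congr rfl fun j _ => Finset.sum_comm
      _ = _ := by
          refine Finset.sum_congr rfl fun j _ => Finset.sum_congr rfl fun l _ =>
            Finset.sum_congr rfl fun a _ => Finset.sum_congr rfl fun b _ => ?_
          ring
  have hup : ∑ j, ∑ l, ((Xᵀ * X) j l) ^ 2 ≤ p * (1 + (p - 1) * worstCaseCoherence X ^ 2) := by
    have hrow : ∀ j, ∑ l, ((Xᵀ * X) j l) ^ 2 ≤ 1 + (p - 1) * worstCaseCoherence X ^ 2 := by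
      intro j
      rw [← Finset.add_sum_erase _ _ (Finset.mem_univ j), hX.gram_self, one_pow]
      gcongr
      calc _ ≤ ∑ l ∈ Finset.univ.erase j, worstCaseCoherence X ^ 2 :=
            Finset.sum_le_sum fun l hl => sq_le_sq'
              (abs_le.1 (abs_gram_le_worstCaseCoherence X (Finset.ne_of_mem_erase hl).symm)).1
              (abs_le.1 (abs_gram_le_worstCaseCoherence X (Finset.ne_of_mem_erase hl).symm)).2
        _ = _ := by
            rw [Finset.sum_const, nsmul_eq_mul, Finset.card_erase_of_mem (Finset.mem_univ j),
              Finset.card_univ, Fintype.card_fin, Nat.cast_sub hp, Nat.cast_one]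
    refine (Finset.sum_le_sum fun j _ => hrow j).trans_eq ?_
    rw [Finset.sum_const, nsmul_eq_mul, Finset.card_univ, Fintype.card_fin]
  -- `X Xᵀ` has trace `p`; apply Cauchy–Schwarz to its `n` diagonal entries.
  have hlow : (p : ℝ) ^ 2 ≤ n * ∑ a, ∑ b, (∑ j, X a j * X b j) ^ 2 := by
    have h1 : ∑ a, ∑ j, X a j ^ 2 = p := by
      rw [Finset.sum_comm]; simp [hX.sum_sq]
    have h2 := sq_sum_le_card_mul_sum_sq (s := Finset.univ) (f := fun a => ∑ j, X a j ^ 2)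
    rw [h1, Finset.card_univ, Fintype.card_fin] at h2
    refine h2.trans ?_
    gcongr with a
    have := Finset.single_le_sum (f := fun b => (∑ j, X a j * X b j) ^ 2)
      (fun b _ => sq_nonneg _) (Finset.mem_univ a)
    simpa [sq] using this
  rw [hfrob] at hlow
  have h3 := hlow.trans (mul_le_mul_of_nonneg_left hup n.cast_nonneg)
  nlinarith

end Coherence

end ExSIS

namespace ExSIS

/-- The row `i` of the Gram matrix of `X`, with its diagonal entry removed. -/
def offDiagGram {n p : ℕ} (X : Matrix (Fin n) (Fin p) ℝ) (i j : Fin p) : ℝ :=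
  if j = i then 0 else (Xᵀ * X) i j

section

variable {n p k : ℕ} {X : Matrix (Fin n) (Fin p) ℝ}

theorem abs_offDiagGram_le (h0 : 0 ≤ worstCaseCoherence X) (i j : Fin p) :
    |offDiagGram X i j| ≤ worstCaseCoherence X := by
  unfold offDiagGram
  split_ifs with h
  · simpa using h0
  · exact abs_gram_le_worstCaseCoherence X (Ne.symm h)

theorem abs_sum_offDiagGram_le (hp : 1 < p) (i : Fin p) :
    |∑ j, offDiagGram X i j| ≤ p * averageCoherence X := by
  have h1 : ∑ j, offDiagGram X i j = ∑ j ∈ Finset.univ.erase i, (Xᵀ * X) i j := by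
    rw [← Finset.add_sum_erase _ _ (Finset.mem_univ i)]
    simp only [offDiagGram, if_true, zero_add]
    exact Finset.sum_congr rfl fun j hj => by rw [if_neg (Finset.ne_of_mem_erase hj)]
  rw [h1]
  nlinarith [abs_sum_gram_le_averageCoherence X hp i, averageCoherence_nonneg X hp]

/-- The marginal correlations are the entries of `β` up to interference and noise. -/
theorem marginalCorrelation_sub (hX : HasUnitColumns X) (z : Fin k → ℝ) (f : Fin k ↪ Fin p)
    (e : Fin n → ℝ) (i : Fin p) :
    (Xᵀ *ᵥ (X *ᵥ place z f + e)) i - place z f i =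
      ∑ a, z a * offDiagGram X i (f a) + ∑ l, X l i * e l := by
  have h1 : ∑ a, z a * offDiagGram X i (f a) = ∑ j, place z f j * offDiagGram X i j :=
    (sum_apply_place z f (fun j b => b * offDiagGram X i j) (fun j => by simp)).symm
  have h2 : (Xᵀ *ᵥ e) i = ∑ l, X l i * e l := rfl
  have h3 : ((Xᵀ * X) *ᵥ place z f) i = ∑ j, (Xᵀ * X) i j * place z f j := rfl
  -- The unit diagonal entry contributes exactly `β i`. Zeroing it keeps all `p` indices in the
  -- population, with no case split on whether `i` was drawn.
  have h4 : ∑ j, (Xᵀ * X) i j * place z f j - place z f i =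
      ∑ j, place z f j * offDiagGram X i j := by
    rw [← Finset.add_sum_erase _ _ (Finset.mem_univ i), hX.gram_self,
      ← Finset.add_sum_erase _ (fun j => place z f j * offDiagGram X i j) (Finset.mem_univ i)]
    simp only [offDiagGram, if_true, mul_zero, zero_add, one_mul, add_sub_cancel_left]
    exact Finset.sum_congr rfl fun j hj => by
      rw [if_neg (Finset.ne_of_mem_erase hj), mul_comm]
  rw [Matrix.mulVec_add, Pi.add_apply, Matrix.mulVec_mulVec, h1, h2, h3, ← h4]
  ring

theorem worstCaseCoherence_pos {c : ℝ} (hX : CoherenceProperty X c) (hp : 1 < p) :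
    0 < worstCaseCoherence X := by
  have h := (averageCoherence_nonneg X hp).trans_lt hX.2.2
  by_contra h0
  exact absurd h (not_lt.2 (div_nonpos_of_nonpos_of_nonneg (not_lt.1 h0) (Real.sqrt_nonneg _)))

/-- By the Welch bound, the sparsity condition forces `100 * k * log p ≤ n`. -/
theorem sparsity_le {c : ℝ} (hc : 10 * √2 < c) (hX : HasUnitColumns X)
    (hμ : 0 < worstCaseCoherence X) (hp : 2 * n ≤ p) (hp1 : 1 < p)
    (hk : (k : ℝ) < (worstCaseCoherence X ^ 2)⁻¹ / (c ^ 2 * Real.log p)) :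
    100 * (k * Real.log p) ≤ n := by
  have hL : 0 < Real.log p := Real.log_pos (by exact_mod_cast hp1)
  have hc2 : 200 ≤ c ^ 2 := by
    have h2 : √2 ^ 2 = 2 := Real.sq_sqrt (by norm_num)
    nlinarith [Real.sqrt_nonneg 2]
  have hp' : 2 * (n : ℝ) ≤ p := by exact_mod_cast hp
  have hw := hX.welch hp1.le
  set m := worstCaseCoherence X ^ 2
  have hm : 0 < m := by positivity
  rw [lt_div_iff₀ (by positivity), ← one_div, lt_div_iff₀ hm] at hk
  have h2 : k * (200 * Real.log p) * m ≤ 1 := le_trans (by gcongr) hk.le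
  have hn : (0 : ℝ) ≤ n := n.cast_nonneg
  have hpp : (0 : ℝ) < p := by exact_mod_cast (by omega : 0 < p)
  -- Welch with `n ≤ p / 2` gives `p / 2 ≤ n * (p - 1) * m`.
  have h3 : 1 ≤ 2 * n * m := by
    have : (p : ℝ) * 1 ≤ p * (2 * n * m) := by nlinarith [mul_nonneg hn hm.le]
    exact le_of_mul_le_mul_left this hpp
  have h4 : (k * (200 * Real.log p)) * m ≤ 2 * n * m := h2.trans h3
  have := le_of_mul_le_mul_right h4 hm
  linarith

end

/-- A union bound in real-valued form, for finitely many events. -/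
theorem measureReal_iUnion_fin_le {Ω : Type*} [MeasurableSpace Ω] (P : Measure Ω)
    [IsFiniteMeasure P] {p : ℕ} (A : Fin p → Set Ω) (B : ℝ) (hA : ∀ i, P.real (A i) ≤ B) :
    P.real (⋃ i, A i) ≤ p * B := by
  refine (measureReal_iUnion_fintype_le A).trans ((Finset.sum_le_sum fun i _ => hA i).trans_eq ?_)
  simp

end ExSIS

/-! ### The main theorem -/

open ExSIS in
theorem corollary3 {n p k : ℕ} {Ω : Type*} [MeasurableSpace Ω] (P : Measure Ω)
    [IsProbabilityMeasure P]
    -- design matrix with the coherence property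
    (X : Matrix (Fin n) (Fin p) ℝ) (cμ : ℝ) (hcμ : 10 * √2 < cμ)
    (hX : ExSIS.CoherenceProperty X cμ)
    -- `k`-sparse parameter vector: nonzero values `z` at uniformly random positions
    (hk : 0 < k) (z : Fin k → ℝ) (hz : ∀ a, z a ≠ 0)
    (π : Ω → (Fin k ↪ Fin p)) (hπ : ExSIS.IsUniformDraw P π)
    (β : Ω → Fin p → ℝ) (hβ : ∀ ω, β ω = ExSIS.place z (π ω))
    -- noise with independent `N(0, σ²)` entries, and the response
    (σ : ℝ≥0) (η : Ω → Fin n → ℝ)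
    (hη_law : ∀ i, HasLaw (fun ω => η ω i) (gaussianReal 0 (σ ^ 2)) P)
    (hη_indep : iIndepFun (fun i ω => η ω i) P)
    (y : Ω → Fin n → ℝ) (hy : ∀ ω, y ω = X *ᵥ β ω + η ω)
    -- conditions on the parameters
    (hp : max (2 * (n : ℝ)) (Real.exp 5) ≤ p)
    (hkμ : (k : ℝ) < (ExSIS.worstCaseCoherence X ^ 2)⁻¹ / (cμ ^ 2 * Real.log p))
    (c₁ c₂ : ℝ) (hc₁ : 2 < c₁) (hc₂ : 2 < c₂)
    (hmsr : ∀ ω, ExSIS.betaMin (β ω) / ExSIS.l2norm (β ω) >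
      2 * cμ * c₁ * ExSIS.worstCaseCoherence X * √(Real.log p)
        + 4 * c₂ * (√((σ : ℝ) ^ 2 * Real.log p) / ExSIS.l2norm (β ω)))
    -- dimension of the screened model
    (d : ℕ) (hd : ⌈(n : ℝ) / Real.log p⌉₊ ≤ d) :
    P.real {ω | ∀ S : Finset (Fin p), ExSIS.IsScreeningOutput X (y ω) d S →
      ExSIS.trueSupport (β ω) ⊆ S} > 1 - 6 / (p : ℝ) := by
  have hp5 : Real.exp 5 ≤ p := (le_max_right _ _).trans hp
  have hp2n : 2 * n ≤ p := by exact_mod_cast (le_max_left _ _).trans hp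
  have hp0 : (0 : ℝ) < p := (Real.exp_pos 5).trans_le hp5
  have hL5 : 5 ≤ Real.log p := (Real.le_log_iff_exp_le hp0).2 hp5
  have hp1 : 1 < p := by
    have h1 : (1 : ℝ) < p := lt_of_lt_of_le (by simp) hp5
    exact_mod_cast h1
  have hμ := worstCaseCoherence_pos hX hp1
  have hkn := sparsity_le hcμ hX.1 hμ hp2n hp1 hkμ
  have hmsr' : ∀ ω, betaMin (β ω) / l2norm (β ω) >
      2 * cμ * c₁ * worstCaseCoherence X * √(Real.log p)
        + 4 * c₂ * (σ * √(Real.log p) / l2norm (β ω)) := fun ω => by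
    have := hmsr ω
    rwa [Real.sqrt_mul (sq_nonneg _), Real.sqrt_sq σ.coe_nonneg] at this
  have hexp : Real.exp (-(2 * Real.log p)) = 1 / (p : ℝ) ^ 2 := by
    rw [Real.exp_neg, two_mul, Real.exp_add, Real.exp_log hp0, sq, one_div]
  set L := Real.log p with hLdef
  set μ := worstCaseCoherence X
  set N := √(∑ a, z a ^ 2)
  have hzpos : 0 < ∑ a, z a ^ 2 :=
    Finset.sum_pos (fun a _ => by have := hz a; positivity) ⟨⟨0, hk⟩, Finset.mem_univ _⟩
  have hN : 0 < N := Real.sqrt_pos.2 hzpos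
  have hN2 : N ^ 2 = ∑ a, z a ^ 2 := Real.sq_sqrt hzpos.le
  have hkr : (0 : ℝ) < k := by exact_mod_cast hk
  have hkn' : k ≤ n := by
    have : (k : ℝ) ≤ n := by nlinarith
    exact_mod_cast this
  have hk4 : 4 * k ≤ p := by
    have : (4 : ℝ) * k ≤ n := by nlinarith
    have : 4 * k ≤ n := by exact_mod_cast this
    omega
  have hkd : k ≤ d := by
    have h1 : (k : ℝ) ≤ n / L := by
      rw [le_div_iff₀ (by linarith)]
      have : 0 ≤ k * L := by positivity
      linarith
    exact_mod_cast h1.trans ((Nat.le_ceil _).trans (by exact_mod_cast hd : _ ≤ (d : ℝ)))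
  have hsL : 1 ≤ √L := Real.one_le_sqrt.2 (by linarith)
  have hbias : √k * averageCoherence X ≤ μ := by
    have hn : (0 : ℝ) < √n := Real.sqrt_pos.2 (by exact_mod_cast hk.trans_le hkn')
    have h1 := (lt_div_iff₀ hn).1 hX.2.2
    have h2 : √(k : ℝ) ≤ √n := Real.sqrt_le_sqrt (by exact_mod_cast hkn')
    nlinarith [averageCoherence_nonneg X hp1]
  have hl2 : ∀ ω, l2norm (β ω) = N := fun ω => by
    have h1 := l2norm_sq (β ω)
    rw [hβ ω, sum_apply_place z (π ω) (fun _ b => b ^ 2) (by simp), ← hN2, ← hβ ω] at h1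
    exact (pow_left_inj₀ (norm_nonneg _) hN.le two_ne_zero).1 h1
  set A : Fin p → Set Ω := fun i => {ω | 16 * √L * μ * N + √k * averageCoherence X * N <
    |∑ a, z a * offDiagGram X i (π ω a)|}
  set B : Fin p → Set Ω := fun i => {ω | 2 * σ * √L < |∑ l, X l i * η ω l|}
  have hA : P.real (⋃ i, A i) ≤ p * (2 * Real.exp (-(2 * L))) :=
    measureReal_iUnion_fin_le P A _ fun i =>
      hπ.measureReal_abs_sum_le _ μ N L _ hμ hN (by linarith) (abs_offDiagGram_le hμ.le i)
        (abs_sum_offDiagGram_le hp1 i) hk hk4 z hN2.symm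
  have hB : P.real (⋃ i, B i) ≤ p * (2 * Real.exp (-(2 * L))) :=
    measureReal_iUnion_fin_le P B _ fun i =>
      measureReal_abs_gaussian_sum_le σ η hη_law hη_indep _ (hX.1.sum_sq i) L (by linarith)
  set E := {ω | ∀ S : Finset (Fin p), IsScreeningOutput X (y ω) d S → trueSupport (β ω) ⊆ S}
  -- Covering the whole space needs only subadditivity, so measurability of `E` is never required.
  have hcover : Set.univ ⊆ E ∪ ((⋃ i, A i) ∪ ⋃ i, B i) := by
    intro ω _
    by_cases hAω : ω ∈ ⋃ i, A i
    · exact Or.inr (Or.inl hAω)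
    by_cases hBω : ω ∈ ⋃ i, B i
    · exact Or.inr (Or.inr hBω)
    left
    rintro S ⟨hS, hSw⟩
    simp only [A, B, Set.mem_iUnion, Set.mem_ofPred_eq, not_exists, not_lt] at hAω hBω
    refine trueSupport_subset_of_abs_sub_le (β ω) _ (17 * √L * μ * N + 2 * σ * √L) ?_ ?_
      (by rw [hβ ω]; exact (card_trueSupport_place_le z (π ω)).trans hkd) S hS hSw
    · intro i
      rw [hy ω, hβ ω, marginalCorrelation_sub hX.1]
      refine (abs_add_le _ _).trans (add_le_add ((hAω i).trans ?_) (hBω i))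
      have : √k * averageCoherence X * N ≤ √L * μ * N :=
        mul_le_mul_of_nonneg_right (hbias.trans (by nlinarith)) hN.le
      linarith
    · intro i hi
      refine lt_of_lt_of_le ?_ (betaMin_le (β ω) i hi)
      have h := hmsr' ω
      rw [hl2 ω, gt_iff_lt, lt_div_iff₀ hN, add_mul] at h
      refine lt_of_le_of_lt ?_ h
      -- With `c₁ > 2` this gives `cμ * c₁ ≥ 28`, which covers the `17` in the error bound.
      have hc : 14 ≤ cμ := by
        have : (1.4 : ℝ) ≤ √2 := Real.le_sqrt_of_sq_le (by norm_num)
        linarith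
      have e1 : 4 * c₂ * (σ * √L / N) * N = 4 * c₂ * (σ * √L) := by field_simp
      rw [e1]
      have h1 : 17 ≤ cμ * c₁ := by nlinarith
      have h2 : 17 * (√L * μ * N) ≤ cμ * c₁ * (√L * μ * N) := by gcongr
      have h3 : 2 * (σ * √L) ≤ c₂ * (σ * √L) := by gcongr
      have h4 : 0 ≤ (σ : ℝ) * √L := by positivity
      nlinarith
  have h1 : (1 : ℝ) ≤ P.real E + (P.real (⋃ i, A i) + P.real (⋃ i, B i)) := by
    rw [← probReal_univ (μ := P)]
    exact (measureReal_mono hcover).trans ((measureReal_union_le _ _).trans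
      (add_le_add le_rfl (measureReal_union_le _ _)))
  have h2 : p * (2 * Real.exp (-(2 * L))) = 2 / p := by
    rw [hexp]; field_simp
  rw [h2] at hA hB
  have h3 : (6 : ℝ) / p = 2 / p + 2 / p + 2 / p := by ring
  have h4 : (0 : ℝ) < 2 / p := by positivity
  linarith
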